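/- Let $H_1,H_2$ be complex Hilbert spaces and let $S,T$ be densely defined closed linear operators from $H_1$ to $H_2$ with $D(S)=D(T)$. Put $\check T=(I+T^*T)^{-1}\in\mathcal B(H_1)$ and $\widehat T=(I+TT^*)^{-1}\in\mathcal B(H_2)$, and similarly for $S$; let $A^{1/2}$ denote the positive square root of a positive operator $A$, and let $\theta(S,T)=\|P_{G(S)}-P_{G(T)}\|$ be the gap between $S$ and $T$, where $P_{G(S)},P_{G(T)}$ are the orthogonal projections of the Hilbert space $H_1\oplus H_2$ onto the graphs of $S$ and $T$. Products and differences of operators are taken on their natural domains, and a linear operator $A$ is called bounded if there is $M>0$ with $\|Ax\|\le M\|x\|$ for all $x\in D(A)$; its norm $\|A\|$ is then the least constant $c\ge 0$ with $\|Ax\|\le c\|x\|$ for all $x\in D(A)$. Then: 1. the operators $\widehat T^{1/2}(T-S)\check S^{1/2}$ and $\widehat S^{1/2}(S-T)\check T^{1/2}$ are defined on all of $H_1$ and bounded, and $$\theta(S,T)=\max\Big\{\big\|\widehat T^{1/2}(T-S)\check S^{1/2}\big\|,\ \big\|\widehat S^{1/2}(S-T)\check T^{1/2}\big\|\Big\};$$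 2. if $T-S$ is bounded, then $\theta(S,T)\le\|S-T\|$. -/

import Mathlib

open scoped InnerProductSpace

noncomputable section

namespace GapMetric

variable {E F G : Type*}
  [NormedAddCommGroup E] [InnerProductSpace ℂ E]
  [NormedAddCommGroup F] [InnerProductSpace ℂ F]
  [NormedAddCommGroup G] [InnerProductSpace ℂ G]

/-- The product `B A` of partially defined operators on its natural domain
`{x ∈ D(A) : A x ∈ D(B)}`. -/
def mul (B : F →ₗ.[ℂ] G) (A : E →ₗ.[ℂ] F) : E →ₗ.[ℂ] G where
  domain :=
    { carrier := {x | ∃ hx : x ∈ A.domain, A ⟨x, hx⟩ ∈ B.domain}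
      zero_mem' := ⟨A.domain.zero_mem, by
        have h : A ⟨0, A.domain.zero_mem⟩ = 0 := A.map_zero
        rw [h]; exact B.domain.zero_mem⟩
      add_mem' := by
        rintro x y ⟨hx, hx'⟩ ⟨hy, hy'⟩
        refine ⟨A.domain.add_mem hx hy, ?_⟩
        have h : A ⟨x + y, A.domain.add_mem hx hy⟩ = A ⟨x, hx⟩ + A ⟨y, hy⟩ :=
          A.map_add ⟨x, hx⟩ ⟨y, hy⟩
        rw [h]; exact B.domain.add_mem hx' hy'
      smul_mem' := by
        rintro c x ⟨hx, hx'⟩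
        refine ⟨A.domain.smul_mem c hx, ?_⟩
        have h : A ⟨c • x, A.domain.smul_mem c hx⟩ = c • A ⟨x, hx⟩ :=
          A.map_smul c ⟨x, hx⟩
        rw [h]; exact B.domain.smul_mem c hx' }
  toFun :=
    { toFun := fun x => B ⟨A ⟨x, x.2.1⟩, x.2.2⟩
      map_add' := by
        intro x y
        rw [← B.map_add]
        congr 1
        exact Subtype.ext (A.map_add ⟨x, x.2.1⟩ ⟨y, y.2.1⟩)
      map_smul' := by
        intro c x
        rw [RingHom.id_apply, ← B.map_smul]
        congr 1
        exact Subtype.ext (A.map_smul c ⟨x, x.2.1⟩) }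

/-- A bounded operator, regarded as a partially defined operator with full domain. -/
def ofCLM (A : E →L[ℂ] F) : E →ₗ.[ℂ] F := (A : E →ₗ[ℂ] F).toPMap ⊤

/-- Boundedness of a partially defined operator:
there is `M > 0` with `‖A x‖ ≤ M ‖x‖` on `D(A)`. -/
def IsBounded (A : E →ₗ.[ℂ] F) : Prop :=
  ∃ M : ℝ, 0 < M ∧ ∀ x : A.domain, ‖A x‖ ≤ M * ‖(x : E)‖

/-- The norm of a bounded partially defined operator: the least `c ≥ 0` with
`‖A x‖ ≤ c ‖x‖` on `D(A)`. It is only meaningful when `IsBounded A` holds. -/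
def opNorm (A : E →ₗ.[ℂ] F) : ℝ :=
  sInf {c : ℝ | 0 ≤ c ∧ ∀ x : A.domain, ‖A x‖ ≤ c * ‖(x : E)‖}

/-- An everywhere defined bounded operator as a continuous linear map. -/
def toCLM (A : E →ₗ.[ℂ] F) (hd : A.domain = ⊤) (hb : IsBounded A) : E →L[ℂ] F :=
  LinearMap.mkContinuousOfExistsBound
    (A.toFun ∘ₗ (LinearEquiv.ofTop A.domain hd).symm.toLinearMap)
    (by
      obtain ⟨M, -, hM⟩ := hb
      exact ⟨M, fun x => hM _⟩)

/-- The operator `(I + P)⁻¹`, with domain the range of `I + P`. -/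
def onePlusInv (P : E →ₗ.[ℂ] E) : E →ₗ.[ℂ] E :=
  (ofCLM (ContinuousLinearMap.id ℂ E) + P).inverse

/-- The graph `{(x, T x) : x ∈ D(T)}` as a subspace of the Hilbert space direct sum `E ⊕ F`. -/
def graphL2 (T : E →ₗ.[ℂ] F) : Submodule ℂ (WithLp 2 (E × F)) :=
  T.graph.comap (WithLp.linearEquiv 2 ℂ (E × F)).toLinearMap

theorem isClosed_graphL2 {T : E →ₗ.[ℂ] F} (hT : T.IsClosed) :
    IsClosed (graphL2 T : Set (WithLp 2 (E × F))) :=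
  IsClosed.preimage (WithLp.prodContinuousLinearEquiv 2 ℂ E F).continuous hT

theorem hasOrthogonalProjection_graphL2 [CompleteSpace E] [CompleteSpace F]
    {T : E →ₗ.[ℂ] F} (hT : T.IsClosed) : (graphL2 T).HasOrthogonalProjection :=
  haveI : CompleteSpace (graphL2 T) := (isClosed_graphL2 hT).completeSpace_coe
  inferInstance

/-- The orthogonal projection of `E ⊕ F` onto the graph of a closed operator. -/
def graphProj [CompleteSpace E] [CompleteSpace F] (T : E →ₗ.[ℂ] F) (hT : T.IsClosed) :
    WithLp 2 (E × F) →L[ℂ] WithLp 2 (E × F) :=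
  haveI := hasOrthogonalProjection_graphL2 hT
  (graphL2 T).starProjection

/-- The gap `‖P_{G(S)} - P_{G(T)}‖` between two closed operators. -/
def gap [CompleteSpace E] [CompleteSpace F] (S T : E →ₗ.[ℂ] F)
    (hS : S.IsClosed) (hT : T.IsClosed) : ℝ :=
  ‖graphProj S hS - graphProj T hT‖

theorem mem_mul_domain {B : F →ₗ.[ℂ] G} {A : E →ₗ.[ℂ] F} {x : E} :
    x ∈ (mul B A).domain ↔ ∃ hx : x ∈ A.domain, A ⟨x, hx⟩ ∈ B.domain := Iff.rfl

theorem mul_apply (B : F →ₗ.[ℂ] G) (A : E →ₗ.[ℂ] F) (x : (mul B A).domain) :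
    mul B A x = B ⟨A ⟨x, x.2.1⟩, x.2.2⟩ := rfl

theorem inner_mul_self {A : E →ₗ.[ℂ] F} {B : F →ₗ.[ℂ] E} (h : B.IsFormalAdjoint A)
    (x : (mul B A).domain) :
    ⟪mul B A x, (x : E)⟫_ℂ = ((‖A ⟨x, x.2.1⟩‖ ^ 2 : ℝ) : ℂ) := by
  rw [mul_apply]
  refine (h ⟨A ⟨x, x.2.1⟩, x.2.2⟩ ⟨x, x.2.1⟩).trans ?_
  rw [inner_self_eq_norm_sq_to_K]
  simp

/-- `I + P` is bounded below by `1` when `P` is nonnegative. -/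
theorem norm_le_onePlus {P : E →ₗ.[ℂ] E}
    (hP : ∀ x : P.domain, 0 ≤ (⟪P x, (x : E)⟫_ℂ).re) (x : P.domain) :
    ‖(x : E)‖ ≤ ‖(x : E) + P x‖ := by
  by_cases h0 : ‖(x : E)‖ = 0
  · rw [h0]; exact norm_nonneg _
  have h1 : ‖(x : E)‖ * ‖(x : E)‖ ≤ ‖(x : E) + P x‖ * ‖(x : E)‖ := by
    calc ‖(x : E)‖ * ‖(x : E)‖
        ≤ (⟪(x : E), (x : E)⟫_ℂ).re + (⟪P x, (x : E)⟫_ℂ).re := by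
          have := inner_self_eq_norm_mul_norm (𝕜 := ℂ) (x : E)
          simp only [RCLike.re_to_complex] at this
          rw [this]; linarith [hP x]
      _ = (⟪(x : E) + P x, (x : E)⟫_ℂ).re := by rw [inner_add_left, Complex.add_re]
      _ ≤ ‖⟪(x : E) + P x, (x : E)⟫_ℂ‖ := Complex.re_le_norm _
      _ ≤ _ := norm_inner_le_norm _ _
  exact le_of_mul_le_mul_right h1 (lt_of_le_of_ne (norm_nonneg _) (Ne.symm h0))

theorem onePlus_apply (P : E →ₗ.[ℂ] E)
    (x : (ofCLM (ContinuousLinearMap.id ℂ E) + P).domain) :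
    (ofCLM (ContinuousLinearMap.id ℂ E) + P) x = (x : E) + P ⟨x, x.2.2⟩ := rfl

theorem onePlus_ker {P : E →ₗ.[ℂ] E}
    (hP : ∀ x : P.domain, 0 ≤ (⟪P x, (x : E)⟫_ℂ).re) :
    LinearMap.ker (ofCLM (ContinuousLinearMap.id ℂ E) + P).toFun = ⊥ := by
  rw [LinearMap.ker_eq_bot']
  intro x hx
  have h := norm_le_onePlus hP ⟨x, x.2.2⟩
  rw [← onePlus_apply] at h
  have hx' : (ofCLM (ContinuousLinearMap.id ℂ E) + P) x = 0 := hx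
  rw [hx', norm_zero] at h
  exact Subtype.ext (norm_le_zero_iff.mp h)

theorem onePlusInv_domain {P : E →ₗ.[ℂ] E}
    (hsurj : ∀ y : E, ∃ x : P.domain, (x : E) + P x = y) :
    (onePlusInv P).domain = ⊤ := by
  rw [onePlusInv, LinearPMap.inverse_domain, LinearMap.range_eq_top]
  intro y
  obtain ⟨x, hx⟩ := hsurj y
  exact ⟨⟨x, trivial, x.2⟩, hx⟩

theorem onePlusInv_isBounded {P : E →ₗ.[ℂ] E}
    (hP : ∀ x : P.domain, 0 ≤ (⟪P x, (x : E)⟫_ℂ).re)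
    (hsurj : ∀ y : E, ∃ x : P.domain, (x : E) + P x = y) :
    IsBounded (onePlusInv P) := by
  refine ⟨1, one_pos, fun y => ?_⟩
  obtain ⟨x, hx⟩ := hsurj y
  have h : onePlusInv P y = x :=
    LinearPMap.inverse_apply_eq (onePlus_ker hP) (x := ⟨x, trivial, x.2⟩) hx
  rw [h, one_mul, ← hx]
  exact norm_le_onePlus hP x

section Resolvents

variable [CompleteSpace E] [CompleteSpace F]

set_option linter.unusedSectionVars false

theorem exists_graph_decomp {T : E →ₗ.[ℂ] F} (hd : Dense (T.domain : Set E))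
    (hc : T.IsClosed) (a : E) (b : F) :
    ∃ u : T.domain, ∃ hv : b - T u ∈ T.adjoint.domain,
      T.adjoint ⟨b - T u, hv⟩ = (u : E) - a := by
  have := hasOrthogonalProjection_graphL2 hc
  set z : WithLp 2 (E × F) := WithLp.toLp 2 (a, b)
  set p := (graphL2 T).starProjection z with hp
  have hpm : p ∈ graphL2 T := Submodule.starProjection_apply_mem _ z
  have hpm' : (p.fst, p.snd) ∈ T.graph := hpm
  obtain ⟨u, hu1, hu2⟩ := (LinearPMap.mem_graph_iff _).mp hpm'
  have horth := Submodule.sub_starProjection_mem_orthogonal (K := graphL2 T) z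
  have key : ∀ w : T.domain, ⟪(u : E) - a, (w : E)⟫_ℂ = ⟪b - T u, T w⟫_ℂ := by
    intro w
    have hw : WithLp.toLp 2 ((w : E), T w) ∈ graphL2 T := T.mem_graph w
    have h := (Submodule.mem_orthogonal' _ _).mp horth _ hw
    rw [WithLp.prod_inner_apply] at h
    have h' : ⟪a - p.fst, (w : E)⟫_ℂ + ⟪b - p.snd, T w⟫_ℂ = 0 := h
    have hu1' : p.fst = (u : E) := hu1.symm
    have hu2' : p.snd = T u := hu2.symm
    rw [hu1', hu2'] at h'
    rw [← neg_sub a (u : E), inner_neg_left]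
    linear_combination -h'
  have hv : b - T u ∈ T.adjoint.domain :=
    LinearPMap.mem_adjoint_domain_of_exists _ ⟨_, key⟩
  exact ⟨u, hv, LinearPMap.adjoint_apply_eq hd _ key⟩

theorem adjoint_mul_self_re_nonneg {T : E →ₗ.[ℂ] F} (hd : Dense (T.domain : Set E))
    (x : (mul T.adjoint T).domain) : 0 ≤ (⟪mul T.adjoint T x, (x : E)⟫_ℂ).re := by
  rw [inner_mul_self (LinearPMap.adjoint_isFormalAdjoint hd), Complex.ofReal_re]
  positivity

theorem mul_adjoint_self_re_nonneg {T : E →ₗ.[ℂ] F} (hd : Dense (T.domain : Set E))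
    (x : (mul T T.adjoint).domain) : 0 ≤ (⟪mul T T.adjoint x, (x : F)⟫_ℂ).re := by
  rw [inner_mul_self (LinearPMap.adjoint_isFormalAdjoint hd).symm, Complex.ofReal_re]
  positivity

theorem one_add_adjoint_mul_self_surj {T : E →ₗ.[ℂ] F} (hd : Dense (T.domain : Set E))
    (hc : T.IsClosed) (y : E) :
    ∃ x : (mul T.adjoint T).domain, (x : E) + mul T.adjoint T x = y := by
  obtain ⟨u, hv, h⟩ := exists_graph_decomp hd hc y 0
  have hm : T u ∈ T.adjoint.domain := by
    have := T.adjoint.domain.neg_mem hv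
    simpa using this
  refine ⟨⟨u, u.2, hm⟩, ?_⟩
  have h2 : T.adjoint ⟨T u, hm⟩ = -T.adjoint ⟨0 - T u, hv⟩ := by
    rw [← LinearPMap.map_neg]
    congr 1
    exact Subtype.ext (by simp)
  have h3 : mul T.adjoint T ⟨u, u.2, hm⟩ = T.adjoint ⟨T u, hm⟩ := rfl
  rw [h3, h2, h]
  simp

theorem one_add_mul_adjoint_self_surj {T : E →ₗ.[ℂ] F} (hd : Dense (T.domain : Set E))
    (hc : T.IsClosed) (y : F) :
    ∃ x : (mul T T.adjoint).domain, (x : F) + mul T T.adjoint x = y := by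
  obtain ⟨u, hv, h⟩ := exists_graph_decomp hd hc 0 y
  rw [sub_zero] at h
  have hm : T.adjoint ⟨y - T u, hv⟩ ∈ T.domain := by rw [h]; exact u.2
  refine ⟨⟨y - T u, hv, hm⟩, ?_⟩
  have h3 : mul T T.adjoint ⟨y - T u, hv, hm⟩ = T u := by
    rw [mul_apply]
    congr 1
    exact Subtype.ext h
  rw [h3]
  simp

/-- The operator `Ť = (I + T* T)⁻¹ ∈ B(E)`. -/
def check (T : E →ₗ.[ℂ] F) (hd : Dense (T.domain : Set E)) (hc : T.IsClosed) : E →L[ℂ] E :=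
  toCLM (onePlusInv (mul T.adjoint T))
    (onePlusInv_domain (one_add_adjoint_mul_self_surj hd hc))
    (onePlusInv_isBounded (adjoint_mul_self_re_nonneg hd)
      (one_add_adjoint_mul_self_surj hd hc))

/-- The operator `T̂ = (I + T T*)⁻¹ ∈ B(F)`. -/
def hat (T : E →ₗ.[ℂ] F) (hd : Dense (T.domain : Set E)) (hc : T.IsClosed) : F →L[ℂ] F :=
  toCLM (onePlusInv (mul T T.adjoint))
    (onePlusInv_domain (one_add_mul_adjoint_self_surj hd hc))
    (onePlusInv_isBounded (mul_adjoint_self_re_nonneg hd)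
      (one_add_mul_adjoint_self_surj hd hc))

/-- `(I + P)⁻¹` is positive in the Loewner order, so that its square root is not a junk value. -/
theorem toCLM_onePlusInv_nonneg {P : E →ₗ.[ℂ] E}
    (hP : ∀ x : P.domain, 0 ≤ (⟪P x, (x : E)⟫_ℂ).re)
    (hsurj : ∀ y : E, ∃ x : P.domain, (x : E) + P x = y)
    (hP' : ∀ x : P.domain, (⟪P x, (x : E)⟫_ℂ).im = 0) :
    0 ≤ toCLM (onePlusInv P) (onePlusInv_domain hsurj) (onePlusInv_isBounded hP hsurj) := by
  rw [ContinuousLinearMap.nonneg_iff_isPositive, ContinuousLinearMap.isPositive_iff_complex]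
  intro y
  obtain ⟨x, hx⟩ := hsurj y
  have h : toCLM (onePlusInv P) (onePlusInv_domain hsurj) (onePlusInv_isBounded hP hsurj) y
      = x :=
    LinearPMap.inverse_apply_eq (onePlus_ker hP) (x := ⟨x, trivial, x.2⟩) hx
  have hs : (⟪(x : E), (x : E)⟫_ℂ) = ((‖(x : E)‖ ^ 2 : ℝ) : ℂ) := by
    rw [inner_self_eq_norm_sq_to_K]; simp
  have hconj : ⟪(x : E), P x⟫_ℂ = (starRingEnd ℂ) ⟪P x, (x : E)⟫_ℂ :=
    (inner_conj_symm _ _).symm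
  rw [h, ← hx, inner_add_right, hs, hconj]
  refine ⟨?_, ?_⟩
  · apply Complex.ext
    · simp
    · have him := hP' x
      simp only [RCLike.re_to_complex, Complex.add_im, Complex.ofReal_im, Complex.conj_im, him]
      simp
  · have := hP x
    simp only [RCLike.re_to_complex, Complex.add_re, Complex.ofReal_re, Complex.conj_re]
    positivity

theorem check_nonneg (T : E →ₗ.[ℂ] F) (hd : Dense (T.domain : Set E)) (hc : T.IsClosed) :
    0 ≤ check T hd hc :=
  toCLM_onePlusInv_nonneg (adjoint_mul_self_re_nonneg hd) (one_add_adjoint_mul_self_surj hd hc) fun x => by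
    rw [inner_mul_self (LinearPMap.adjoint_isFormalAdjoint hd), Complex.ofReal_im]

theorem hat_nonneg (T : E →ₗ.[ℂ] F) (hd : Dense (T.domain : Set E)) (hc : T.IsClosed) :
    0 ≤ hat T hd hc :=
  toCLM_onePlusInv_nonneg (mul_adjoint_self_re_nonneg hd) (one_add_mul_adjoint_self_surj hd hc) fun x => by
    rw [inner_mul_self (LinearPMap.adjoint_isFormalAdjoint hd).symm, Complex.ofReal_im]

/-- The operator `T̂^{1/2} (T - S) Š^{1/2}`, on the natural domain of this product. -/
def sandwich (T S : E →ₗ.[ℂ] F)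
    (hTd : Dense (T.domain : Set E)) (hTc : T.IsClosed)
    (hSd : Dense (S.domain : Set E)) (hSc : S.IsClosed) : E →ₗ.[ℂ] F :=
  mul (ofCLM (CFC.sqrt (hat T hTd hTc))) (mul (T - S) (ofCLM (CFC.sqrt (check S hSd hSc))))

end Resolvents

end GapMetric

end

/-!
Write `P`, `Q` for the projections onto the graphs `G(S)`, `G(T)`. Since `P - Q` is the difference
of `(1 - Q) P` and `Q (1 - P)`, which have orthogonal initial and final spaces, its norm is the
larger of `‖(1 - Q) P‖` and `‖(1 - P) Q‖` (`norm_starProjection_sub_eq_max`). By symmetry it remains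
to identify the first of these with the norm of `T̂^{1/2} (T - S) Š^{1/2}`.

The operator `Š` is the compression of `P` to the first summand (`check_apply_eq`), and `T̂` is the
compression of `1 - Q` to the second (`hat_apply_eq`). An isometric polar decomposition
(`exists_isometry_onto_of_compression`) therefore yields isometries `V` onto `G(S)` and `W` onto
`G(T)ᗮ` whose first, respectively second, component is `Š^{1/2}`, respectively `T̂^{1/2}`. In
particular `V x = (s, S s)` with `s = Š^{1/2} x`, so `Š^{1/2}` maps into `D(S) = D(T)`. As `W y` is
orthogonal to `(s, T s)`, one gets `⟪W y, V x⟫ = ⟪T̂^{1/2} y, (S - T) s⟫`, that is,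
`T̂^{1/2} (T - S) Š^{1/2} = -W† V` (`exists_clm_eq_sandwich`); and `‖W† V‖ = ‖W W† V V†‖ =
‖(1 - Q) P‖`. The bound by `‖S - T‖` follows because `Š^{1/2}` and `T̂^{1/2}`, being components of
isometries, are contractions.
-/

namespace GapMetric

/-! ### Isometries and orthogonal projections in Hilbert spaces -/

open ContinuousLinearMap in
/-- Isometric polar decomposition of `P L†`, where `P` is the orthogonal projection onto `K`:
when `P L†` is injective and `L` is injective on `K`, the isometric factor `V` maps the whole space
onto `K`, and its `L`-component is the positive square root of `A = L P L†`. -/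
theorem exists_isometry_onto_of_compression {E H : Type*}
    [NormedAddCommGroup E] [InnerProductSpace ℂ E] [CompleteSpace E]
    [NormedAddCommGroup H] [InnerProductSpace ℂ H] [CompleteSpace H]
    (K : Submodule ℂ H) [K.HasOrthogonalProjection] (L : H →L[ℂ] E) (A : E →L[ℂ] E)
    (hA : 0 ≤ A) (hAL : ∀ x, A x = L (K.starProjection (adjoint L x)))
    (hinj : ∀ x, adjoint L x ∈ Kᗮ → x = 0) (hK : ∀ z ∈ K, L z = 0 → z = 0) :
    ∃ V : E →L[ℂ] H, adjoint V ∘L V = .id ℂ E ∧ V ∘L adjoint V = K.starProjection ∧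
      L ∘L V = CFC.sqrt A := by
  set P := K.starProjection with hP
  set R := CFC.sqrt A
  have hPadj : adjoint P = P := isSelfAdjoint_starProjection K
  have hPK : ∀ z, P z ∈ K := fun z => Submodule.starProjection_apply_mem K z
  have hRR : R ∘L R = A := CFC.sqrt_mul_sqrt_self A hA
  have hRadj : adjoint R = R := (CFC.sqrt_nonneg A).isSelfAdjoint
  have hnorm : ∀ x, ‖P (adjoint L x)‖ = ‖R x‖ := by
    intro x
    have h : ⟪R x, R x⟫_ℂ = ⟪P (adjoint L x), P (adjoint L x)⟫_ℂ := by
      calc ⟪R x, R x⟫_ℂ = ⟪adjoint R (R x), x⟫_ℂ := (adjoint_inner_left R _ _).symm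
        _ = ⟪L (P (adjoint L x)), x⟫_ℂ := by
            rw [hRadj, ← hAL, ← hRR]; rfl
        _ = ⟪P (P (adjoint L x)), adjoint L x⟫_ℂ := by
            rw [← adjoint_inner_right, Submodule.starProjection_eq_self_iff.mpr (hPK _)]
        _ = _ := by
            nth_rw 1 [← hPadj]
            rw [adjoint_inner_left]
    rw [inner_self_eq_norm_sq_to_K, inner_self_eq_norm_sq_to_K] at h
    have h' : ‖R x‖ ^ 2 = ‖P (adjoint L x)‖ ^ 2 := by exact_mod_cast h
    exact ((sq_eq_sq₀ (norm_nonneg _) (norm_nonneg _)).mp h').symm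
  have hRinj : ∀ x, R x = 0 → x = 0 := fun x hx =>
    hinj x <| (Submodule.starProjection_apply_eq_zero_iff K).mp <| by
      rw [← norm_eq_zero, ← hP, hnorm, hx, norm_zero]
  have hdense : DenseRange R := by
    have h : Dense (R.range : Set E) := by
      rw [Submodule.dense_iff_topologicalClosure_eq_top,
        Submodule.topologicalClosure_eq_top_iff, orthogonal_range, hRadj, LinearMap.ker_eq_bot']
      exact hRinj
    exact h
  let V : E →L[ℂ] H := (P ∘L adjoint L).toLinearMap.extendOfNorm R.toLinearMap
  have hVR : ∀ x, V (R x) = P (adjoint L x) :=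
    LinearMap.extendOfNorm_eq (f := (P ∘L adjoint L).toLinearMap) (e := R.toLinearMap) hdense
      ⟨1, fun x => by rw [one_mul]; exact (hnorm x).le⟩
  have hVnorm : ∀ x, ‖V x‖ = ‖x‖ := congrFun <|
    hdense.equalizer (g := fun x => ‖V x‖) (h := fun x => ‖x‖) (by fun_prop) (by fun_prop) <|
      funext fun x => by simp [hVR, hnorm]
  have hPV : ∀ x, P (V x) = V x := congrFun <|
    hdense.equalizer (g := fun x => P (V x)) (h := fun x => V x) (by fun_prop) (by fun_prop) <|
      funext fun x => by
        simpa [hVR] using Submodule.starProjection_eq_self_iff.mpr (hPK _)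
  have hLV : L ∘L V = R := ContinuousLinearMap.ext <| congrFun <|
    hdense.equalizer (g := fun x => L (V x)) (h := fun x => R x) (by fun_prop) (by fun_prop) <|
      funext fun x => by
        simp only [Function.comp_apply, hVR, ← hAL]
        rw [← hRR]; rfl
  refine ⟨V, (norm_map_iff_adjoint_comp_self V).mp hVnorm, ?_, hLV⟩
  ext z
  have hmem : P z - V (adjoint V z) ∈ K :=
    K.sub_mem (hPK z) (by rw [← hPV]; exact hPK _)
  -- `L (P - V V†) = 0` is the adjoint of `V V† L† = V R = P L†`.
  have hL : L (P z - V (adjoint V z)) = 0 := by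
    refine ext_inner_left ℂ fun x => ?_
    have h : adjoint V (adjoint L x) = R x := by
      have := congrArg adjoint hLV
      rw [adjoint_comp, hRadj] at this
      exact congrArg (· x) this
    rw [inner_zero_right, ← adjoint_inner_left, inner_sub_right, ← adjoint_inner_left P, hPadj,
      ← adjoint_inner_left V, h, adjoint_inner_right, hVR, sub_self]
  exact (sub_eq_zero.mp (hK _ hmem hL)).symm

open ContinuousLinearMap in
/-- The splitting `P - Q = (1 - Q) P - Q (1 - P)` has orthogonal terms, each of which is bounded by
its own half of the orthogonal decomposition of a vector along `P`. -/
theorem norm_starProjection_sub_eq_max {H : Type*}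
    [NormedAddCommGroup H] [InnerProductSpace ℂ H] [CompleteSpace H]
    (U V : Submodule ℂ H) [U.HasOrthogonalProjection] [V.HasOrthogonalProjection] :
    ‖U.starProjection - V.starProjection‖ =
      max ‖Vᗮ.starProjection ∘L U.starProjection‖ ‖Uᗮ.starProjection ∘L V.starProjection‖ := by
  set m := max ‖Vᗮ.starProjection ∘L U.starProjection‖ ‖Uᗮ.starProjection ∘L V.starProjection‖
  have hm0 : 0 ≤ m := le_max_of_le_left (norm_nonneg _)
  have hidem : ∀ (W : Submodule ℂ H) [W.HasOrthogonalProjection] (z : H),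
      W.starProjection (W.starProjection z) = W.starProjection z := fun W _ z =>
    Submodule.starProjection_eq_self_iff.mpr (Submodule.starProjection_apply_mem W z)
  have half : ∀ (U V : Submodule ℂ H) [U.HasOrthogonalProjection] [V.HasOrthogonalProjection],
      ‖Vᗮ.starProjection ∘L U.starProjection‖ ≤ ‖U.starProjection - V.starProjection‖ := by
    intro U V _ _
    have h : Vᗮ.starProjection ∘L U.starProjection
        = Vᗮ.starProjection ∘L (U.starProjection - V.starProjection) := by
      ext z
      simp [hidem]
    rw [h]
    exact (opNorm_comp_le _ _).trans
      (mul_le_of_le_one_left (norm_nonneg _) (Submodule.starProjection_norm_le _))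
  apply le_antisymm
  · refine opNorm_le_bound _ hm0 fun z => ?_
    set a := U.starProjection z
    set b := Uᗮ.starProjection z
    have hz : ‖z‖ ^ 2 = ‖a‖ ^ 2 + ‖b‖ ^ 2 := Submodule.norm_sq_eq_add_norm_sq_starProjection z U
    have hsum : a + b = z := by simp [a, b]
    have h1 : ‖Vᗮ.starProjection a‖ ≤ m * ‖a‖ := by
      have h := (Vᗮ.starProjection ∘L U.starProjection).le_opNorm a
      rw [coe_comp, Function.comp_apply, hidem] at h
      exact h.trans (by gcongr; exact le_max_left _ _)
    have h2 : ‖V.starProjection b‖ ≤ m * ‖b‖ := by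
      have h := (V.starProjection ∘L Uᗮ.starProjection).le_opNorm b
      rw [coe_comp, Function.comp_apply, hidem] at h
      refine h.trans ?_
      gcongr
      rw [← LinearIsometryEquiv.norm_map adjoint, adjoint_comp,
        (isSelfAdjoint_starProjection V).adjoint_eq, (isSelfAdjoint_starProjection Uᗮ).adjoint_eq]
      exact le_max_right _ _
    have hdec : (U.starProjection - V.starProjection) z
        = Vᗮ.starProjection a - V.starProjection b := by
      rw [Submodule.starProjection_orthogonal_val, sub_sub, ← map_add, hsum]; rfl
    have hV : ‖(U.starProjection - V.starProjection) z‖ ^ 2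
        = ‖V.starProjection b‖ ^ 2 + ‖Vᗮ.starProjection a‖ ^ 2 := by
      have h := Submodule.norm_sq_eq_add_norm_sq_starProjection
        ((U.starProjection - V.starProjection) z) V
      rw [h, hdec]
      simp [hidem]
    rw [← pow_le_pow_iff_left₀ (norm_nonneg _) (by positivity) two_ne_zero, hV, mul_pow, hz]
    have h1' := pow_le_pow_left₀ (norm_nonneg _) h1 2
    have h2' := pow_le_pow_left₀ (norm_nonneg _) h2 2
    rw [mul_pow] at h1' h2'
    linarith
  · refine max_le (half U V) ?_
    rw [norm_sub_rev]
    exact half V U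

open ContinuousLinearMap in
/-- `W W†` and `V V†` are the projections onto the ranges of the isometries `W` and `V`. -/
theorem norm_adjoint_comp_of_isometry {E F H : Type*}
    [NormedAddCommGroup E] [InnerProductSpace ℂ E] [CompleteSpace E]
    [NormedAddCommGroup F] [InnerProductSpace ℂ F] [CompleteSpace F]
    [NormedAddCommGroup H] [InnerProductSpace ℂ H] [CompleteSpace H]
    {W : F →L[ℂ] H} {V : E →L[ℂ] H}
    (hW : adjoint W ∘L W = .id ℂ F) (hV : adjoint V ∘L V = .id ℂ E) :
    ‖adjoint W ∘L V‖ = ‖(W ∘L adjoint W) ∘L (V ∘L adjoint V)‖ := by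
  have hWn : ∀ y, ‖W y‖ = ‖y‖ := (norm_map_iff_adjoint_comp_self W).mpr hW
  have hVn : ∀ x, ‖V x‖ = ‖x‖ := (norm_map_iff_adjoint_comp_self V).mpr hV
  have hVV : ∀ x, adjoint V (V x) = x := fun x => congrArg (· x) hV
  apply le_antisymm
  · refine opNorm_le_bound _ (norm_nonneg _) fun x => ?_
    have h := ((W ∘L adjoint W) ∘L (V ∘L adjoint V)).le_opNorm (V x)
    simpa only [comp_apply, hVV, hWn, hVn] using h
  · refine opNorm_le_bound _ (norm_nonneg _) fun z => ?_
    have hVn' : ‖adjoint V z‖ ≤ ‖z‖ := by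
      have h : ‖V‖ ≤ 1 := opNorm_le_bound _ zero_le_one fun x => by rw [hVn, one_mul]
      rw [← LinearIsometryEquiv.norm_map adjoint] at h
      simpa using (adjoint V).le_of_opNorm_le h z
    simp only [comp_apply, hWn]
    exact ((adjoint W ∘L V).le_opNorm _).trans (by gcongr)

/-! ### Norms of partially defined operators -/

variable {E F : Type*}
  [NormedAddCommGroup E] [InnerProductSpace ℂ E]
  [NormedAddCommGroup F] [InnerProductSpace ℂ F]

theorem norm_le_opNorm_mul {A : E →ₗ.[ℂ] F} (hA : IsBounded A) (x : A.domain) :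
    ‖A x‖ ≤ opNorm A * ‖(x : E)‖ := by
  obtain ⟨M, hM, h⟩ := hA
  have hne : {c : ℝ | 0 ≤ c ∧ ∀ x : A.domain, ‖A x‖ ≤ c * ‖(x : E)‖}.Nonempty :=
    ⟨M, hM.le, h⟩
  by_cases hx : ‖(x : E)‖ = 0
  · simpa [hx] using h x
  · have hx' : 0 < ‖(x : E)‖ := lt_of_le_of_ne (norm_nonneg _) (Ne.symm hx)
    rw [← div_le_iff₀ hx']
    exact le_csInf hne fun c hc => (div_le_iff₀ hx').mpr (hc.2 x)

theorem opNorm_nonneg (A : E →ₗ.[ℂ] F) : 0 ≤ opNorm A :=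
  Real.sInf_nonneg fun _ h => h.1

theorem isBounded_of_eq_clm {A : E →ₗ.[ℂ] F} (B : E →L[ℂ] F) (h : ∀ x : A.domain, A x = B x) :
    IsBounded A :=
  ⟨‖B‖ + 1, by positivity, fun x => by
    rw [h]
    exact (B.le_opNorm x).trans (by gcongr; linarith)⟩

theorem opNorm_eq_norm_of_eq_clm {A : E →ₗ.[ℂ] F} (B : E →L[ℂ] F) (hd : A.domain = ⊤)
    (h : ∀ x : A.domain, A x = B x) : opNorm A = ‖B‖ := by
  have hd' : ∀ x, x ∈ A.domain := fun x => hd ▸ Submodule.mem_top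
  rw [opNorm, ContinuousLinearMap.norm_def]
  congr 1
  ext c
  refine and_congr_right fun _ => ⟨fun H x => ?_, fun H x => ?_⟩
  · rw [← h ⟨x, hd' x⟩]; exact H ⟨x, hd' x⟩
  · rw [h]; exact H x

theorem IsBounded.sub_comm {A B : E →ₗ.[ℂ] F} (h : IsBounded (A - B)) : IsBounded (B - A) := by
  obtain ⟨M, hM, h⟩ := h
  refine ⟨M, hM, fun x => ?_⟩
  have := h ⟨x, x.2.2, x.2.1⟩
  rwa [LinearPMap.sub_apply, norm_sub_rev] at this

theorem opNorm_sub_comm (A B : E →ₗ.[ℂ] F) : opNorm (A - B) = opNorm (B - A) := by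
  have key : ∀ (A B : E →ₗ.[ℂ] F) (c : ℝ), (∀ x : (A - B).domain, ‖(A - B) x‖ ≤ c * ‖(x : E)‖) →
      ∀ x : (B - A).domain, ‖(B - A) x‖ ≤ c * ‖(x : E)‖ := by
    intro A B c h x
    have := h ⟨x, x.2.2, x.2.1⟩
    rwa [LinearPMap.sub_apply, norm_sub_rev] at this
  unfold opNorm
  congr 1
  ext c
  exact and_congr_right fun _ => ⟨key A B c, key B A c⟩

/-! ### Graphs of closed operators and their complements -/

theorem toCLM_onePlusInv_apply_eq {P : E →ₗ.[ℂ] E}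
    (hP : ∀ x : P.domain, 0 ≤ (⟪P x, (x : E)⟫_ℂ).re)
    (hd : (onePlusInv P).domain = ⊤) (hb : IsBounded (onePlusInv P))
    {x : P.domain} {y : E} (hx : (x : E) + P x = y) : toCLM (onePlusInv P) hd hb y = x :=
  LinearPMap.inverse_apply_eq (onePlus_ker hP) (x := ⟨x, trivial, x.2⟩) hx

theorem mem_graphL2_iff {T : E →ₗ.[ℂ] F} {z : WithLp 2 (E × F)} :
    z ∈ graphL2 T ↔ ∃ u : T.domain, z = WithLp.toLp 2 ((u : E), T u) := by
  have h : z ∈ graphL2 T ↔ (z.fst, z.snd) ∈ T.graph := Iff.rfl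
  rw [h, LinearPMap.mem_graph_iff]
  refine exists_congr fun u => ⟨fun ⟨h1, h2⟩ => ?_, ?_⟩
  · exact (WithLp.ofLp_injective 2) (Prod.ext h1.symm h2.symm)
  · rintro rfl
    exact ⟨rfl, rfl⟩

theorem eq_zero_of_mem_graphL2 {T : E →ₗ.[ℂ] F} {z : WithLp 2 (E × F)}
    (hz : z ∈ graphL2 T) (h : z.fst = 0) : z = 0 := by
  obtain ⟨u, rfl⟩ := mem_graphL2_iff.mp hz
  have hu : u = 0 := Subtype.ext h
  rw [hu, LinearPMap.map_zero]
  rfl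

theorem eq_zero_of_mem_graphL2_orthogonal {T : E →ₗ.[ℂ] F} (hd : Dense (T.domain : Set E))
    {z : WithLp 2 (E × F)} (hz : z ∈ (graphL2 T)ᗮ) (h : z.snd = 0) : z = 0 := by
  have h1 : z.fst = 0 := hd.eq_zero_of_mem_orthogonal (K := T.domain) <| by
    intro w hw
    have := hz _ (mem_graphL2_iff.mpr ⟨⟨w, hw⟩, rfl⟩)
    rwa [WithLp.prod_inner_apply, show (WithLp.ofLp z).2 = 0 from h, inner_zero_right,
      add_zero] at this
  exact (WithLp.ofLp_injective 2) (Prod.ext h1 h)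

variable [CompleteSpace E]

/-- The orthogonal decomposition of `(a, b)` along the graph: its complementary part is
`(-T* v, v)` with `v = b - T u`. -/
theorem starProjection_graphL2_eq {T : E →ₗ.[ℂ] F} [(graphL2 T).HasOrthogonalProjection]
    (hd : Dense (T.domain : Set E)) {a : E} {b : F} {u : T.domain}
    (hv : b - T u ∈ T.adjoint.domain) (h : T.adjoint ⟨b - T u, hv⟩ = (u : E) - a) :
    (graphL2 T).starProjection (WithLp.toLp 2 (a, b)) = WithLp.toLp 2 ((u : E), T u) := by
  refine Submodule.eq_starProjection_of_mem_orthogonal (mem_graphL2_iff.mpr ⟨u, rfl⟩) ?_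
  rw [Submodule.mem_orthogonal']
  intro z hz
  obtain ⟨w, rfl⟩ := mem_graphL2_iff.mp hz
  have key : ⟪T.adjoint ⟨b - T u, hv⟩, (w : E)⟫_ℂ = ⟪b - T u, T w⟫_ℂ :=
    LinearPMap.adjoint_isFormalAdjoint hd ⟨b - T u, hv⟩ w
  rw [WithLp.prod_inner_apply]
  change ⟪a - u, (w : E)⟫_ℂ + ⟪b - T u, T w⟫_ℂ = 0
  rw [← key, h, ← inner_add_left]
  simp

variable [CompleteSpace F]

theorem adjoint_fstL_apply (a : E) :
    ContinuousLinearMap.adjoint (WithLp.fstL 2 ℂ E F) a = WithLp.toLp 2 (a, 0) := by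
  refine ext_inner_right ℂ fun z => ?_
  rw [ContinuousLinearMap.adjoint_inner_left, WithLp.prod_inner_apply]
  simp

theorem adjoint_sndL_apply (b : F) :
    ContinuousLinearMap.adjoint (WithLp.sndL 2 ℂ E F) b = WithLp.toLp 2 (0, b) := by
  refine ext_inner_right ℂ fun z => ?_
  rw [ContinuousLinearMap.adjoint_inner_left, WithLp.prod_inner_apply]
  simp

/-- The operator `Ť` is the compression to `E` of the projection onto the graph of `T`. -/
theorem check_apply_eq {T : E →ₗ.[ℂ] F} [(graphL2 T).HasOrthogonalProjection]
    (hd : Dense (T.domain : Set E)) (hc : T.IsClosed) (a : E) :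
    check T hd hc a = ((graphL2 T).starProjection (WithLp.toLp 2 (a, 0))).fst := by
  obtain ⟨u, hv, h⟩ := exists_graph_decomp hd hc a 0
  rw [starProjection_graphL2_eq hd hv h]
  have hm : T u ∈ T.adjoint.domain := by simpa using T.adjoint.domain.neg_mem hv
  refine toCLM_onePlusInv_apply_eq (adjoint_mul_self_re_nonneg hd) _ _ (x := ⟨u, u.2, hm⟩) ?_
  have h2 : T.adjoint ⟨T u, hm⟩ = -T.adjoint ⟨0 - T u, hv⟩ := by
    rw [← LinearPMap.map_neg]
    congr 1
    exact Subtype.ext (by simp)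
  change (u : E) + T.adjoint ⟨T u, hm⟩ = a
  rw [h2, h]
  simp

/-- The operator `T̂` is the compression to `F` of the projection onto the orthogonal complement of
the graph of `T`. -/
theorem hat_apply_eq {T : E →ₗ.[ℂ] F} [(graphL2 T).HasOrthogonalProjection]
    (hd : Dense (T.domain : Set E)) (hc : T.IsClosed) (b : F) :
    hat T hd hc b = ((graphL2 T)ᗮ.starProjection (WithLp.toLp 2 (0, b))).snd := by
  obtain ⟨u, hv, h⟩ := exists_graph_decomp hd hc 0 b
  rw [Submodule.starProjection_orthogonal_val, starProjection_graphL2_eq hd hv h]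
  rw [sub_zero] at h
  have hm : T.adjoint ⟨b - T u, hv⟩ ∈ T.domain := h ▸ u.2
  refine toCLM_onePlusInv_apply_eq (mul_adjoint_self_re_nonneg hd) _ _
    (x := ⟨b - T u, hv, hm⟩) ?_
  have h3 : mul T T.adjoint ⟨b - T u, hv, hm⟩ = T u := by
    rw [mul_apply]
    congr 1
    exact Subtype.ext h
  rw [h3]
  simp

open ContinuousLinearMap in
/-- The isometry `x ↦ (Š^{1/2} x, S Š^{1/2} x)` onto the graph of `S`. -/
theorem exists_isometry_onto_graphL2 {S : E →ₗ.[ℂ] F} [(graphL2 S).HasOrthogonalProjection]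
    (hd : Dense (S.domain : Set E)) (hc : S.IsClosed) :
    ∃ V : E →L[ℂ] WithLp 2 (E × F), adjoint V ∘L V = .id ℂ E ∧
      V ∘L adjoint V = (graphL2 S).starProjection ∧
      WithLp.fstL 2 ℂ E F ∘L V = CFC.sqrt (check S hd hc) := by
  refine exists_isometry_onto_of_compression (graphL2 S) (WithLp.fstL 2 ℂ E F) _
    (check_nonneg S hd hc) (fun x => ?_) (fun x hx => ?_)
    (fun z hz h => eq_zero_of_mem_graphL2 hz h)
  · rw [adjoint_fstL_apply, check_apply_eq]; rfl
  · rw [adjoint_fstL_apply] at hx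
    exact congrArg WithLp.fst (eq_zero_of_mem_graphL2_orthogonal hd hx rfl)

open ContinuousLinearMap in
/-- The isometry `y ↦ (-T* T̂^{1/2} y, T̂^{1/2} y)` onto the orthogonal complement of the graph
of `T`. -/
theorem exists_isometry_onto_graphL2_orthogonal {T : E →ₗ.[ℂ] F}
    [(graphL2 T).HasOrthogonalProjection]
    (hd : Dense (T.domain : Set E)) (hc : T.IsClosed) :
    ∃ W : F →L[ℂ] WithLp 2 (E × F), adjoint W ∘L W = .id ℂ F ∧
      W ∘L adjoint W = (graphL2 T)ᗮ.starProjection ∧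
      WithLp.sndL 2 ℂ E F ∘L W = CFC.sqrt (hat T hd hc) := by
  refine exists_isometry_onto_of_compression (graphL2 T)ᗮ (WithLp.sndL 2 ℂ E F) _
    (hat_nonneg T hd hc) (fun x => ?_) (fun x hx => ?_)
    (fun z hz h => eq_zero_of_mem_graphL2_orthogonal hd hz h)
  · rw [adjoint_sndL_apply, hat_apply_eq]; rfl
  · rw [adjoint_sndL_apply, Submodule.orthogonal_orthogonal] at hx
    exact congrArg WithLp.snd (eq_zero_of_mem_graphL2 hx rfl)

/-! ### The sandwiched difference -/

open ContinuousLinearMap in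
/-- With `V` and `W` the isometries onto `G(S)` and `G(T)ᗮ`, the operator `-W† V` is the sandwich:
pairing `W y ⟂ (s, T s)` with `V x = (s, S s)`, where `s = Š^{1/2} x`, leaves only the second
components. -/
theorem exists_clm_eq_sandwich {S T : E →ₗ.[ℂ] F}
    [(graphL2 S).HasOrthogonalProjection] [(graphL2 T).HasOrthogonalProjection]
    (hSd : Dense (S.domain : Set E)) (hSc : S.IsClosed)
    (hTd : Dense (T.domain : Set E)) (hTc : T.IsClosed) (hST : S.domain = T.domain) :
    ∃ B : E →L[ℂ] F, (sandwich T S hTd hTc hSd hSc).domain = ⊤ ∧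
      (∀ x : (sandwich T S hTd hTc hSd hSc).domain, sandwich T S hTd hTc hSd hSc x = B x) ∧
      ‖B‖ = ‖(graphL2 T)ᗮ.starProjection ∘L (graphL2 S).starProjection‖ ∧
      (IsBounded (T - S) → ‖B‖ ≤ opNorm (T - S)) := by
  obtain ⟨V, hV, hVV, hV1⟩ := exists_isometry_onto_graphL2 hSd hSc
  obtain ⟨W, hW, hWW, hW2⟩ := exists_isometry_onto_graphL2_orthogonal hTd hTc
  have hVmem : ∀ x, V x ∈ graphL2 S := fun x => by
    have h : (graphL2 S).starProjection (V x) = V x := by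
      rw [← hVV]
      exact congrArg V (congrArg (· x) hV)
    rw [← h]
    exact Submodule.starProjection_apply_mem _ _
  have hWmem : ∀ y, W y ∈ (graphL2 T)ᗮ := fun y => by
    have h : (graphL2 T)ᗮ.starProjection (W y) = W y := by
      rw [← hWW]
      exact congrArg W (congrArg (· y) hW)
    rw [← h]
    exact Submodule.starProjection_apply_mem _ _
  have hVfst : ∀ x, (V x).fst = CFC.sqrt (check S hSd hSc) x := fun x => congrArg (· x) hV1
  have hWsnd : ∀ y, (W y).snd = CFC.sqrt (hat T hTd hTc) y := fun y => congrArg (· y) hW2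
  have hVnorm : ∀ x, ‖V x‖ = ‖x‖ := (norm_map_iff_adjoint_comp_self V).mpr hV
  have hWnorm : ∀ y, ‖W y‖ = ‖y‖ := (norm_map_iff_adjoint_comp_self W).mpr hW
  have hs : ∀ x, CFC.sqrt (check S hSd hSc) x ∈ S.domain := fun x => by
    obtain ⟨u, hu⟩ := mem_graphL2_iff.mp (hVmem x)
    rw [← hVfst, hu]
    exact u.2
  have hsT : ∀ x, CFC.sqrt (check S hSd hSc) x ∈ (T - S).domain := fun x =>
    ⟨hST ▸ hs x, hs x⟩
  have hdom : (sandwich T S hTd hTc hSd hSc).domain = ⊤ :=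
    Submodule.eq_top_iff'.mpr fun x => ⟨⟨trivial, hsT x⟩, trivial⟩
  have happ : ∀ x : (sandwich T S hTd hTc hSd hSc).domain,
      sandwich T S hTd hTc hSd hSc x =
        CFC.sqrt (hat T hTd hTc) ((T - S) ⟨CFC.sqrt (check S hSd hSc) x, hsT x⟩) :=
    fun x => rfl
  have hB : ∀ x : (sandwich T S hTd hTc hSd hSc).domain,
      sandwich T S hTd hTc hSd hSc x = (-(adjoint W ∘L V)) x := by
    intro x
    set s := CFC.sqrt (check S hSd hSc) (x : E)
    have hsS : s ∈ S.domain := hs x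
    have hsT' : s ∈ T.domain := hST ▸ hsS
    have hVx : V x = WithLp.toLp 2 (s, S ⟨s, hsS⟩) := by
      obtain ⟨u, hu⟩ := mem_graphL2_iff.mp (hVmem x)
      obtain rfl : u = ⟨s, hsS⟩ :=
        Subtype.ext ((congrArg WithLp.fst hu).symm.trans (hVfst x))
      exact hu
    have hsub : V x - WithLp.toLp 2 (s, T ⟨s, hsT'⟩)
        = -WithLp.toLp 2 ((0 : E), (T - S) ⟨s, hsT x⟩) := by
      rw [hVx, LinearPMap.sub_apply]
      refine (WithLp.ofLp_injective 2) (Prod.ext ?_ ?_)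
      · simp
      · simp
    refine ext_inner_left ℂ fun y => ?_
    have horth : ⟪W y, WithLp.toLp 2 (s, T ⟨s, hsT'⟩)⟫_ℂ = 0 :=
      (Submodule.mem_orthogonal' _ _).mp (hWmem y) _ (mem_graphL2_iff.mpr ⟨⟨s, hsT'⟩, rfl⟩)
    have hWV : ⟪W y, V x⟫_ℂ = -⟪CFC.sqrt (hat T hTd hTc) y, (T - S) ⟨s, hsT x⟩⟫_ℂ := by
      rw [← sub_zero ⟪W y, V x⟫_ℂ, ← horth, ← inner_sub_right, hsub, inner_neg_right,
        WithLp.prod_inner_apply, ← hWsnd]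
      simp
    have hsa : adjoint (CFC.sqrt (hat T hTd hTc)) = CFC.sqrt (hat T hTd hTc) :=
      (CFC.sqrt_nonneg (hat T hTd hTc)).isSelfAdjoint
    rw [happ, neg_apply, inner_neg_right, comp_apply, adjoint_inner_right, hWV, neg_neg,
      ← adjoint_inner_left, hsa]
  refine ⟨-(adjoint W ∘L V), hdom, hB, ?_, fun hb => ?_⟩
  · rw [norm_neg, ← hWW, ← hVV, norm_adjoint_comp_of_isometry hW hV]
  · refine opNorm_le_bound _ (opNorm_nonneg _) fun x => ?_
    rw [← hB ⟨x, hdom ▸ Submodule.mem_top⟩, happ]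
    -- Components of the isometries `V` and `W` are contractions.
    have hsn : ‖CFC.sqrt (check S hSd hSc) x‖ ≤ ‖x‖ := by
      rw [← hVfst]; exact (WithLp.norm_fst_le _ _).trans_eq (hVnorm x)
    have htn : ∀ y, ‖CFC.sqrt (hat T hTd hTc) y‖ ≤ ‖y‖ := fun y => by
      rw [← hWsnd]; exact (WithLp.norm_snd_le _ _).trans_eq (hWnorm y)
    refine (htn _).trans ((norm_le_opNorm_mul hb _).trans ?_)
    gcongr
    · exact opNorm_nonneg _

end GapMetric

theorem theorem3p1 {H₁ H₂ : Type*}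
    [NormedAddCommGroup H₁] [InnerProductSpace ℂ H₁] [CompleteSpace H₁]
    [NormedAddCommGroup H₂] [InnerProductSpace ℂ H₂] [CompleteSpace H₂]
    (S T : H₁ →ₗ.[ℂ] H₂)
    (hSd : Dense (S.domain : Set H₁)) (hSc : S.IsClosed)
    (hTd : Dense (T.domain : Set H₁)) (hTc : T.IsClosed)
    (hST : S.domain = T.domain) :
    ((GapMetric.sandwich T S hTd hTc hSd hSc).domain = ⊤ ∧
      GapMetric.IsBounded (GapMetric.sandwich T S hTd hTc hSd hSc) ∧
      (GapMetric.sandwich S T hSd hSc hTd hTc).domain = ⊤ ∧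
      GapMetric.IsBounded (GapMetric.sandwich S T hSd hSc hTd hTc) ∧
      GapMetric.gap S T hSc hTc =
        max (GapMetric.opNorm (GapMetric.sandwich T S hTd hTc hSd hSc))
          (GapMetric.opNorm (GapMetric.sandwich S T hSd hSc hTd hTc))) ∧
    (GapMetric.IsBounded (T - S) →
      GapMetric.gap S T hSc hTc ≤ GapMetric.opNorm (S - T)) := by
  have := GapMetric.hasOrthogonalProjection_graphL2 hSc
  have := GapMetric.hasOrthogonalProjection_graphL2 hTc
  obtain ⟨B, hBd, hB, hBn, hBb⟩ := GapMetric.exists_clm_eq_sandwich hSd hSc hTd hTc hST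
  obtain ⟨C, hCd, hC, hCn, hCb⟩ := GapMetric.exists_clm_eq_sandwich hTd hTc hSd hSc hST.symm
  have hgap : GapMetric.gap S T hSc hTc = max ‖B‖ ‖C‖ := by
    rw [hBn, hCn]
    exact GapMetric.norm_starProjection_sub_eq_max _ _
  refine ⟨⟨hBd, GapMetric.isBounded_of_eq_clm B hB, hCd, GapMetric.isBounded_of_eq_clm C hC, ?_⟩,
    fun hb => ?_⟩
  · rw [hgap, GapMetric.opNorm_eq_norm_of_eq_clm B hBd hB,
      GapMetric.opNorm_eq_norm_of_eq_clm C hCd hC]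
  · rw [hgap]
    exact max_le ((hBb hb).trans_eq (GapMetric.opNorm_sub_comm T S)) (hCb hb.sub_comm)
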